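/- Let $\mathcal{A}$ be a skeletally small abelian length category, i.e. an abelian category in which every object has a composition series; all subcategories are full and closed under isomorphisms. A torsion class is a non-empty subcategory closed under quotients and extensions; $\mathsf{tors}\,\mathcal{A}$ is the complete lattice of torsion classes ordered by inclusion, and $\mathsf{T}(\mathcal{C})$ is the smallest torsion class containing a class $\mathcal{C}$ of objects. A wide subcategory is a non-empty subcategory closed under kernels, cokernels and extensions; $\mathsf{wide}\,\mathcal{A}$ is the set of them. A torsion class is widely generated if it equals $\mathsf{T}(\mathcal{W})$ for some wide subcategory $\mathcal{W}$. A brick is an object whose endomorphism ring is a division ring; a semibrick is a set of isomorphism classes of bricks such that there is no non-zero morphism between non-isomorphic members; $\mathsf{sbrick}\,\mathcal{A}$ is the set of semibricks. $\mathsf{Filt}(\mathcal{C})$ is the subcategory of all $M$ with a finite filtration $0=M_0\subseteq M_1\subseteq\cdots\subseteq M_n=M$ with all $M_i/M_{i-1}\in\mathcal{C}$. $\mathsf{simp}\,\mathcal{W}$ is the set of isomorphism classes of simple objects of the abelian category $\mathcal{W}$. For $\mathcal{T}\in\mathsf{tors}\,\mathcal{A}$ let $$\mathsf{W}_L(\mathcal{T})=\{W\in\mathcal{T}\mid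 \ker f\in\mathcal{T}\text{ for every } f\colon T\to W \text{ with } T\in\mathcal{T}\}.$$ For an element $x$ of a complete lattice $L$, a canonical join representation of $x$ is an antichain $A\subseteq L$ with $x=\bigvee A$ such that, for every $B\subseteq L$ with $x=\bigvee B$, each $a\in A$ satisfies $a\le b$ for some $b\in B$. It is unique if it exists and is then denoted $\mathrm{CJR}(x)$; $L_0$ is the set of $x\in L$ for which it exists. For $\mathcal{T}\in(\mathsf{tors}\,\mathcal{A})_0$ let $\overline{\mathrm{CJR}}(\mathcal{T})$ be the set of isomorphism classes of bricks $B$ with $\mathsf{T}(B)\in\mathrm{CJR}(\mathcal{T})$. Then: 1. A torsion class $\mathcal{T}$ is widely generated if and only if $\mathrm{CJR}(\mathcal{T})$ exists in $\mathsf{tors}\,\mathcal{A}$. 2. $\mathsf{T}\colon\mathsf{wide}\,\mathcal{A}\to(\mathsf{tors}\,\mathcal{A})_0$ and $\mathsf{W}_L\colon(\mathsf{tors}\,\mathcal{A})_0\to\mathsf{wide}\,\mathcal{A}$ are mutually inverse bijections. 3. $\overline{\mathrm{CJR}}(\mathcal{T})$ is a semibrick for every $\mathcal{T}\in(\mathsf{tors}\,\mathcal{A})_0$,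 and $\mathsf{T}\colon\mathsf{sbrick}\,\mathcal{A}\to(\mathsf{tors}\,\mathcal{A})_0$ and $\overline{\mathrm{CJR}}\colon(\mathsf{tors}\,\mathcal{A})_0\to\mathsf{sbrick}\,\mathcal{A}$ are mutually inverse bijections. 4. $\mathsf{Filt}\colon\mathsf{sbrick}\,\mathcal{A}\to\mathsf{wide}\,\mathcal{A}$ and $\mathsf{simp}\colon\mathsf{wide}\,\mathcal{A}\to\mathsf{sbrick}\,\mathcal{A}$ are mutually inverse bijections, and they are compatible with the bijections in 2 and 3: $\mathsf{T}(\mathsf{Filt}\,\mathcal{S})=\mathsf{T}(\mathcal{S})$ for $\mathcal{S}\in\mathsf{sbrick}\,\mathcal{A}$, $\mathsf{T}(\mathsf{simp}\,\mathcal{W})=\mathsf{T}(\mathcal{W})$ for $\mathcal{W}\in\mathsf{wide}\,\mathcal{A}$, and $\mathsf{Filt}(\overline{\mathrm{CJR}}(\mathcal{T}))=\mathsf{W}_L(\mathcal{T})$ and $\mathsf{simp}(\mathsf{W}_L(\mathcal{T}))=\overline{\mathrm{CJR}}(\mathcal{T})$ for $\mathcal{T}\in(\mathsf{tors}\,\mathcal{A})_0$.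 -/

import Mathlib

open CategoryTheory CategoryTheory.Limits

universe v u

namespace TorsWide

section Lattice

variable {L : Type u} [CompleteLattice L]

/-- `x = ⋁ A` is a canonical join representation of `x` (in the complete sense): `A` refines every
subset `B` with `x = ⋁ B`, infinite ones and redundant ones included, and `A` is an antichain. -/
structure IsCanonicalJoinRep (x : L) (A : Set L) : Prop where
  sSup_eq : x = sSup A
  refines : ∀ B : Set L, x = sSup B → ∀ a ∈ A, ∃ b ∈ B, a ≤ b
  antichain : ∀ a₁ ∈ A, ∀ a₂ ∈ A, a₁ ≤ a₂ → a₁ = a₂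

/-- A canonical join representation is unique if it exists. -/
theorem IsCanonicalJoinRep.unique {x : L} {A B : Set L}
    (hA : IsCanonicalJoinRep x A) (hB : IsCanonicalJoinRep x B) : A = B := by
  have key : ∀ {A B : Set L}, IsCanonicalJoinRep x A → IsCanonicalJoinRep x B → A ⊆ B := by
    intro A B hA hB a ha
    obtain ⟨b, hb, hab⟩ := hA.refines B hB.sSup_eq a ha
    obtain ⟨a', ha', hba'⟩ := hB.refines A hA.sSup_eq b hb
    have h := hA.antichain a ha a' ha' (hab.trans hba')
    have h2 : a = b := le_antisymm hab (h ▸ hba')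
    exact h2 ▸ hb
  exact Set.Subset.antisymm (key hA hB) (key hB hA)

variable (L) in
/-- The set `L₀` of elements that have a canonical join representation. -/
def canonicalElements : Set L := {x | ∃ A : Set L, IsCanonicalJoinRep x A}

/-- The canonical join representation of `x`, if it exists; the empty set otherwise. -/
def CJR (x : L) : Set L := {a | ∃ A : Set L, IsCanonicalJoinRep x A ∧ a ∈ A}

theorem IsCanonicalJoinRep.cjr_eq {x : L} {A : Set L} (hA : IsCanonicalJoinRep x A) :
    CJR x = A := by
  ext a
  constructor
  · rintro ⟨B, hB, ha⟩
    exact hA.unique hB ▸ ha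
  · intro ha
    exact ⟨A, hA, ha⟩

end Lattice

section Category

variable {C : Type u} [Category.{v} C] [Abelian C]

/-- `Filt P`: the objects `M` with a finite filtration `0 = M₀ ⊆ M₁ ⊆ ⋯ ⊆ Mₙ = M` all of whose
factors `Mᵢ₊₁ / Mᵢ` are isomorphic to objects in `P`. -/
def Filt (P : ObjectProperty C) : ObjectProperty C := fun M =>
  ∃ (n : ℕ) (F : ℕ → Subobject M) (hF : Monotone F), F 0 = ⊥ ∧ F n = ⊤ ∧
    ∀ i < n, P.isoClosure (cokernel ((F i).ofLE (F (i + 1)) (hF (Nat.le_succ i))))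

variable (C) in
/-- An abelian category is a length category if every object has a composition series, that is, a
finite filtration with simple factors. -/
def IsLengthCategory : Prop := ∀ M : C, Filt (fun X : C => Simple X) M

/-- Torsion classes: closed under quotients and extensions (and containing zero objects). -/
structure IsTorsionClass (P : ObjectProperty C) : Prop extends
  P.ContainsZero, P.IsClosedUnderQuotients, P.IsClosedUnderExtensions

/-- Wide subcategories: closed under kernels, cokernels and extensions (and containing zero
objects). -/
structure IsWide (P : ObjectProperty C) : Prop extends
  P.ContainsZero, P.IsClosedUnderKernels, P.IsClosedUnderCokernels, P.IsClosedUnderExtensions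

variable (C) in
/-- The set of wide subcategories. -/
def wide : Set (ObjectProperty C) := {W | IsWide W}

variable (C) in
/-- The poset of torsion classes, ordered by inclusion. -/
abbrev Tors : Type u := {P : ObjectProperty C // IsTorsionClass P}

/-- An intersection of torsion classes is a torsion class. -/
theorem isTorsionClass_inter (S : Set (Tors C)) :
    IsTorsionClass (fun X : C => ∀ T ∈ S, T.1 X) where
  exists_zero := ⟨_, isZero_zero C, fun T _ => by
    have := T.2.toContainsZero
    have := T.2.toIsClosedUnderQuotients
    exact T.1.prop_of_isZero (isZero_zero C)⟩
  prop_of_epi f _ hX := fun T hT => T.2.prop_of_epi f (hX T hT)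
  prop_X₂_of_shortExact hS h₁ h₃ := fun T hT =>
    T.2.prop_X₂_of_shortExact hS (h₁ T hT) (h₃ T hT)

instance : InfSet (Tors C) := ⟨fun S => ⟨fun X => ∀ T ∈ S, T.1 X, isTorsionClass_inter S⟩⟩

/-- Torsion classes form a complete lattice, in which meets are intersections. -/
noncomputable instance : CompleteLattice (Tors C) :=
  completeLatticeOfInf (Tors C) fun _ =>
    ⟨fun _ hT _ hX => hX _ hT, fun _ hU X hX T hT => hU hT X hX⟩

/-- `torsGen P` is the smallest torsion class that contains `P`. -/
noncomputable def torsGen (P : ObjectProperty C) : Tors C := sInf {T : Tors C | P ≤ T.1}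

theorem isLeast_torsGen (P : ObjectProperty C) :
    IsLeast {T : Tors C | P ≤ T.1} (torsGen P) :=
  ⟨fun _ hX _ hT => hT _ hX, fun _ hT => sInf_le hT⟩

/-- A torsion class is widely generated if it is the smallest torsion class containing some wide
subcategory. -/
def IsWidelyGenerated (T : Tors C) : Prop := ∃ W ∈ wide C, T = torsGen W

/-- A brick is an object whose endomorphism ring is a division ring. -/
def IsBrick (B : C) : Prop := Nontrivial (End B) ∧ ∀ f : End B, f ≠ 0 → IsUnit f

/-- A semibrick, i.e. a set of isomorphism classes of pairwise Hom-orthogonal bricks, given as the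
isomorphism-closed class of the objects that represent them. -/
structure IsSemibrick (S : ObjectProperty C) : Prop extends S.IsClosedUnderIsomorphisms where
  isBrick : ∀ B : C, S B → IsBrick B
  hom_eq_zero : ∀ B₁ B₂ : C, S B₁ → S B₂ → ¬ Nonempty (B₁ ≅ B₂) → ∀ f : B₁ ⟶ B₂, f = 0

variable (C) in
/-- The set of semibricks. -/
def sbrick : Set (ObjectProperty C) := {S | IsSemibrick S}

/-- `simp W`: the objects of `W` that are simple objects of the category `W` itself. -/
def simp (W : ObjectProperty C) : ObjectProperty C := fun X =>
  ∃ h : W X, Simple (⟨X, h⟩ : W.FullSubcategory)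

/-- `W_L(T)`: the objects `W` of `T` such that all morphisms from objects of `T` to `W` have their
kernel in `T`. -/
def WL (T : Tors C) : ObjectProperty C := fun W =>
  T.1 W ∧ ∀ (X : C) (f : X ⟶ W), T.1 X → T.1 (kernel f)

/-- The brick version of `CJR`: the bricks `B` for which the torsion class generated by `B` is an
element of `CJR T`. -/
def brickCJR (T : Tors C) : ObjectProperty C := fun B =>
  IsBrick B ∧ torsGen (ObjectProperty.singleton B) ∈ CJR T

end Category

end TorsWide

open TorsWide

/-!
In a length category, `T(P)` is the left orthogonal of `P^⊥`. For a semibrick `S`, a non-zero map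
from an object of `T(S)` to a brick in `S` is an epimorphism, with kernel again in `T(S)`: an
extension of a brick in `S` by an object of `S^⊥` lies in `S^⊥` or splits. Hence `S ⊆ W_L(T(S))`,
and since non-zero maps from `S` to `W_L(T(S))` are monomorphisms, splitting off bricks of `S` from
below gives `W_L(T(S)) = Filt S`. By Schur's lemma the simple objects of a wide subcategory form a
semibrick, which identifies semibricks with wide subcategories.

Every torsion class is the join of the `T(B)` over its bricks `B`, so the members of a canonical
join representation are of the form `T(B)`. Canonicity forces these bricks to be Hom-orthogonal,
and conversely the `T(B)` with `B` in a semibrick `S` refine every family whose join is `T(S)`.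
-/

namespace TorsWide

variable {C : Type u} [Category.{v} C] [Abelian C]

section ExtensionClosed

theorem shortExact_of_epi {X Y : C} (p : X ⟶ Y) [Epi p] :
    (ShortComplex.mk (kernel.ι p) p (kernel.condition p)).ShortExact where
  exact := ShortComplex.exact_of_f_is_kernel _ (kernelIsKernel p)

theorem shortExact_of_mono {X Y : C} (i : X ⟶ Y) [Mono i] :
    (ShortComplex.mk i (cokernel.π i) (cokernel.condition i)).ShortExact where
  exact := ShortComplex.exact_of_g_is_cokernel _ (cokernelIsCokernel i)

variable (P : ObjectProperty C) [P.IsClosedUnderExtensions]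

theorem prop_of_prop_kernel {X Y : C} (p : X ⟶ Y) [Epi p] (hK : P (kernel p)) (hY : P Y) : P X :=
  P.prop_X₂_of_shortExact (shortExact_of_epi p) hK hY

theorem prop_of_prop_cokernel {X Y : C} (i : X ⟶ Y) [Mono i] (hX : P X) (hQ : P (cokernel i)) :
    P Y :=
  P.prop_X₂_of_shortExact (shortExact_of_mono i) hX hQ

/-- An isomorphism `X ≅ Y` makes `Y` an extension of `X` by a zero object. -/
instance isClosedUnderIsomorphisms_of_isClosedUnderExtensions [P.ContainsZero] :
    P.IsClosedUnderIsomorphisms where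
  of_iso {X Y} e hX := by
    obtain ⟨Z, hZ, hPZ⟩ := P.exists_prop_of_containsZero
    have hS : (ShortComplex.mk (0 : Z ⟶ Y) e.inv zero_comp).ShortExact :=
      { exact := (ShortComplex.exact_iff_mono _ rfl).2 (inferInstanceAs (Mono e.inv))
        mono_f := ⟨fun _ _ _ => hZ.eq_of_tgt _ _⟩
        epi_g := inferInstanceAs (Epi e.inv) }
    exact P.prop_X₂_of_shortExact hS hPZ hX

end ExtensionClosed

theorem isIso_cokernel_map_of_isPullback {A B E F : C} {f : A ⟶ B} {g : E ⟶ F} {p : A ⟶ E}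
    {q : B ⟶ F} (sq : IsPullback f p q g) [Epi q] : IsIso (cokernel.map f g p q sq.w) := by
  have : Mono (cokernel.map f g p q sq.w) := Abelian.mono_cokernel_map_of_isPullback sq
  have : Epi (cokernel.map f g p q sq.w) := by
    have : Epi (cokernel.π f ≫ cokernel.map f g p q sq.w) := by
      rw [cokernel.π_desc]; infer_instance
    exact epi_of_epi (cokernel.π f) _
  exact isIso_of_mono_of_epi _

instance epi_pullbackπ {X Y : C} (f : X ⟶ Y) [Epi f] (A : Subobject Y) :
    Epi (Subobject.pullbackπ f A) :=
  (MorphismProperty.epimorphisms C).of_isPullback (Subobject.isPullback f A).flip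
    (MorphismProperty.epimorphisms.infer_property f)

section Filtration

variable {P : ObjectProperty C} {M N : C}

/-- `IsStep P X Y`: the subobject `X` is contained in `Y`, with quotient `Y / X` isomorphic to an
object in `P`; these are the steps of the filtrations that define `Filt P`. -/
def IsStep (P : ObjectProperty C) {M : C} (X Y : Subobject M) : Prop :=
  ∃ h : X ≤ Y, P.isoClosure (cokernel (X.ofLE Y h))

theorem isStep_of_iso {A B : C} {X Y : Subobject M} (h : X ≤ Y)
    (g : A ⟶ B) (eX : (X : C) ≅ A) (eY : (Y : C) ≅ B) (w : X.ofLE Y h ≫ eY.hom = eX.hom ≫ g)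
    (hg : P.isoClosure (cokernel g)) : IsStep P X Y :=
  ⟨h, P.isoClosure.prop_of_iso (cokernel.mapIso _ _ eX eY w).symm hg⟩

theorem IsStep.map {X Y : Subobject M} (h : IsStep P X Y) (i : M ⟶ N) [Mono i] :
    IsStep P ((Subobject.map i).obj X) ((Subobject.map i).obj Y) := by
  obtain ⟨hXY, hP⟩ := h
  have map_eq (Z : Subobject M) : (Subobject.map i).obj Z = Subobject.mk (Z.arrow ≫ i) := by
    rw [← Subobject.map_mk, Subobject.mk_arrow]
  refine isStep_of_iso ((Subobject.map i).monotone hXY) (X.ofLE Y hXY)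
    (Subobject.isoOfEqMk _ _ (map_eq X)) (Subobject.isoOfEqMk _ _ (map_eq Y)) ?_ hP
  rw [← cancel_mono (Y.arrow ≫ i)]
  simp

theorem IsStep.pullback {X Y : Subobject N} (h : IsStep P X Y) (p : M ⟶ N) [Epi p] :
    IsStep P ((Subobject.pullback p).obj X) ((Subobject.pullback p).obj Y) := by
  obtain ⟨hXY, hP⟩ := h
  have hle := (Subobject.pullback p).monotone hXY
  have comm : Subobject.ofLE _ _ hle ≫ Subobject.pullbackπ p Y =
      Subobject.pullbackπ p X ≫ X.ofLE Y hXY := by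
    rw [← cancel_mono Y.arrow]
    simp [(Subobject.isPullback p Y).w, (Subobject.isPullback p X).w]
  have outer : IsPullback (Subobject.pullbackπ p X)
      (Subobject.ofLE _ _ hle ≫ ((Subobject.pullback p).obj Y).arrow) (X.ofLE Y hXY ≫ Y.arrow)
      p := by
    simpa using Subobject.isPullback p X
  have sq := (outer.of_bot comm.symm (Subobject.isPullback p Y)).flip
  have := isIso_cokernel_map_of_isPullback sq
  exact ⟨hle, P.isoClosure.prop_of_iso (asIso (cokernel.map _ _ _ _ sq.w)).symm hP⟩

theorem exists_seq_of_reflTransGen {α : Type*} {r : α → α → Prop} {a b : α}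
    (h : Relation.ReflTransGen r a b) :
    ∃ (n : ℕ) (F : ℕ → α), F 0 = a ∧ (∀ i < n, r (F i) (F (i + 1))) ∧ ∀ i ≥ n, F i = b := by
  induction h using Relation.ReflTransGen.head_induction_on with
  | refl => exact ⟨0, fun _ => b, rfl, by simp, by simp⟩
  | @head a _ hac _ ih =>
    obtain ⟨n, F, rfl, hstep, hconst⟩ := ih
    refine ⟨n + 1, fun i => i.casesOn a F, rfl, fun i hi => ?_, fun i hi => ?_⟩
    · cases i with
      | zero => exact hac
      | succ i => exact hstep i (by omega)
    · cases i with
      | zero => omega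
      | succ i => exact hconst i (by omega)

theorem filt_iff_reflTransGen :
    Filt P M ↔ Relation.ReflTransGen (IsStep P) (⊥ : Subobject M) ⊤ := by
  constructor
  · rintro ⟨n, F, hF, h0, hn, hstep⟩
    rw [← h0, ← hn]
    exact Relation.ReflTransGen.lift F (fun _ _ h => h) _ _
      (reflTransGen_of_succ_of_le (fun i j => IsStep P (F i) (F j))
        (fun i hi => ⟨hF i.le_succ, hstep i hi.2⟩) n.zero_le)
  · intro h
    obtain ⟨n, F, h0, hstep, hconst⟩ := exists_seq_of_reflTransGen h
    have hF : Monotone F := monotone_nat_of_le_succ fun i => by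
      rcases lt_or_ge i n with hi | hi
      · exact (hstep i hi).1
      · exact ((hconst i hi).trans (hconst (i + 1) (by omega)).symm).le
    exact ⟨n, F, hF, h0, hconst n le_rfl, fun i hi => (hstep i hi).2⟩

theorem pullback_bot_of_shortExact {S : ShortComplex C} (hS : S.ShortExact) [Mono S.f] :
    (Subobject.pullback S.g).obj ⊥ = Subobject.mk S.f := by
  have sq := Subobject.isPullback S.g ⊥
  rw [Subobject.bot_arrow] at sq
  exact le_antisymm
    (Subobject.le_mk_of_comm (hS.exact.lift _ (by rw [← sq.w, comp_zero])) (hS.exact.lift_f _ _))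
    (Subobject.mk_le_of_comm (sq.lift 0 S.f (by simp)) (sq.lift_snd _ _ _))

instance : (Filt P).ContainsZero where
  exists_zero := ⟨_, isZero_zero C, filt_iff_reflTransGen.2 (by
    have := Subobject.subsingleton_of_isZero (isZero_zero C)
    rw [Subsingleton.elim (⊥ : Subobject _) ⊤])⟩

instance : (Filt P).IsClosedUnderExtensions where
  prop_X₂_of_shortExact {S} hS h₁ h₃ := by
    have := hS.mono_f
    have := hS.epi_g
    rw [filt_iff_reflTransGen] at h₁ h₃ ⊢
    have lower : Relation.ReflTransGen (IsStep P) ⊥ (Subobject.mk S.f) := by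
      simpa only [Function.onFun, Subobject.map_bot, Subobject.map_top] using
        Relation.ReflTransGen.lift (Subobject.map S.f).obj (fun _ _ h => h.map S.f) _ _ h₁
    have upper : Relation.ReflTransGen (IsStep P) (Subobject.mk S.f) ⊤ := by
      simpa only [Function.onFun, pullback_bot_of_shortExact hS, Subobject.pullback_top] using
        Relation.ReflTransGen.lift (Subobject.pullback S.g).obj (fun _ _ h => h.pullback S.g) _ _ h₃
    exact lower.trans upper

theorem le_filt (P : ObjectProperty C) : P ≤ Filt P := fun X hX =>
  filt_iff_reflTransGen.2 <| .single <| by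
    refine isStep_of_iso bot_le (0 : _ ⟶ X) Subobject.botCoeIsoZero
      (asIso (⊤ : Subobject X).arrow) (by simp) ?_
    exact P.isoClosure.prop_of_iso cokernelZeroIsoTarget.symm (P.le_isoClosure _ hX)

theorem filt_le {Q : ObjectProperty C} [Q.ContainsZero] [Q.IsClosedUnderExtensions]
    (hPQ : P ≤ Q) : Filt P ≤ Q := fun M hM => by
  have key {X : Subobject M} (h : Relation.ReflTransGen (IsStep P) ⊥ X) : Q (X : C) := by
    induction h with
    | refl => exact Q.prop_of_isZero ((isZero_zero C).of_iso Subobject.botCoeIsoZero)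
    | tail _ hstep ih =>
      obtain ⟨hle, hY⟩ := hstep
      exact prop_of_prop_cokernel Q _ ih (ObjectProperty.isoClosure_le_iff .. |>.2 hPQ _ hY)
  exact Q.prop_of_iso (asIso (⊤ : Subobject M).arrow) (key (filt_iff_reflTransGen.1 hM))

end Filtration

section SubobjectChains

theorem subobject_le_of_pullback_le_of_image_le {S : ShortComplex C} (hS : S.ShortExact)
    {N N' : Subobject S.X₂} (hle : N ≤ N')
    (hpull : (Subobject.pullback S.f).obj N' ≤ (Subobject.pullback S.f).obj N)
    (him : imageSubobject (N'.arrow ≫ S.g) ≤ imageSubobject (N.arrow ≫ S.g)) : N' ≤ N := by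
  have := hS.mono_f
  obtain ⟨A, π, _, x, hx⟩ := surjective_up_to_refinements_of_epi
    (factorThruImageSubobject (N.arrow ≫ S.g))
    (factorThruImageSubobject (N'.arrow ≫ S.g) ≫ Subobject.ofLE _ _ him)
  have hxg : (π ≫ N'.arrow - x ≫ N.arrow) ≫ S.g = 0 := by
    have := congrArg (· ≫ (imageSubobject (N.arrow ≫ S.g)).arrow) hx
    simpa [sub_eq_zero] using this
  let y : A ⟶ S.X₁ := hS.exact.lift _ hxg
  have hy : y ≫ S.f = π ≫ N'.arrow - x ≫ N.arrow := hS.exact.lift_f _ hxg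
  have hyN' : N'.Factors (y ≫ S.f) :=
    (Subobject.factors_iff _ _).2 ⟨π - x ≫ Subobject.ofLE N N' hle, by simpa using hy.symm⟩
  have hyN : N.Factors (y ≫ S.f) :=
    (pullback_factors_iff S.f N y).1
      (Subobject.factors_of_le y hpull ((pullback_factors_iff S.f N' y).2 hyN'))
  have hzero : N'.arrow ≫ cokernel.π N.arrow = 0 := by
    rw [← cancel_epi π, ← Category.assoc, ← sub_add_cancel (π ≫ N'.arrow) (x ≫ N.arrow), ← hy,
      Preadditive.add_comp, ← N.factorThru_arrow _ hyN]
    simp only [Category.assoc, cokernel.condition, comp_zero, add_zero]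
  exact Subobject.le_of_comm (Abelian.monoLift N.arrow _ hzero) (Abelian.monoLift_comp _ _ hzero)

theorem strictMono_pullback_image {S : ShortComplex C} (hS : S.ShortExact) :
    StrictMono fun N : Subobject S.X₂ =>
      ((Subobject.pullback S.f).obj N, imageSubobject (N.arrow ≫ S.g)) := fun N N' h => by
  refine lt_of_le_not_ge ⟨(Subobject.pullback S.f).monotone h.le, ?_⟩ fun hge =>
    h.not_ge (subobject_le_of_pullback_le_of_image_le hS h.le hge.1 hge.2)
  simpa using imageSubobject_comp_le (N.ofLE N' h.le) (N'.arrow ≫ S.g)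

instance : (isNoetherianObject (C := C)).IsClosedUnderExtensions where
  prop_X₂_of_shortExact {S} hS h₁ h₃ := by
    have : IsNoetherianObject S.X₁ := ⟨h₁⟩
    have : IsNoetherianObject S.X₃ := ⟨h₃⟩
    exact (strictMono_pullback_image hS).wellFoundedGT

instance : (isArtinianObject (C := C)).IsClosedUnderExtensions where
  prop_X₂_of_shortExact {S} hS h₁ h₃ := by
    have : IsArtinianObject S.X₁ := ⟨h₁⟩
    have : IsArtinianObject S.X₃ := ⟨h₃⟩
    exact (strictMono_pullback_image hS).wellFoundedLT

instance finite_subobject_of_simple {X : C} [Simple X] : Finite (Subobject X) := by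
  classical exact Finite.of_equiv Bool IsSimpleOrder.equivBool.symm

theorem IsLengthCategory.isNoetherianObject (hC : IsLengthCategory C) (X : C) :
    IsNoetherianObject X :=
  have simple_le : (fun Y : C => Simple Y) ≤ CategoryTheory.isNoetherianObject :=
    fun Y (_ : Simple Y) => (inferInstance : WellFoundedGT (Subobject Y))
  ⟨filt_le simple_le X (hC X)⟩

theorem IsLengthCategory.isArtinianObject (hC : IsLengthCategory C) (X : C) :
    IsArtinianObject X :=
  have simple_le : (fun Y : C => Simple Y) ≤ CategoryTheory.isArtinianObject :=
    fun Y (_ : Simple Y) => (inferInstance : WellFoundedLT (Subobject Y))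
  ⟨filt_le simple_le X (hC X)⟩

end SubobjectChains

section KernelPullback

variable (P : ObjectProperty C)

theorem prop_kernel_iff_of_isPullback [P.IsClosedUnderIsomorphisms] {A B E F : C} {f : A ⟶ B}
    {g : E ⟶ F} {p : A ⟶ E} {q : B ⟶ F} (sq : IsPullback f p q g) :
    P (kernel f) ↔ P (kernel g) :=
  have := isIso_kernel_map_of_isPullback sq
  P.prop_iff_of_iso (asIso (kernel.map f g p q sq.w))

theorem prop_pullback [P.ContainsZero] [P.IsClosedUnderExtensions] {X Y Z : C} (p : X ⟶ Z)
    (g : Y ⟶ Z) [Epi p] (hK : P (kernel p)) (hY : P Y) : P (pullback p g) :=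
  prop_of_prop_kernel P (pullback.snd p g)
    ((prop_kernel_iff_of_isPullback P (IsPullback.of_hasPullback p g).flip).2 hK) hY

end KernelPullback

section ChainConditions

variable {P : ObjectProperty C} {M : C}

theorem prop_of_forall_quotient_exists_mono [P.ContainsZero] [P.IsClosedUnderExtensions]
    [IsNoetherianObject M]
    (h : ∀ (Q : C) (p : M ⟶ Q) [Epi p], P (kernel p) → ¬IsZero Q →
      ∃ (Y : C) (j : Y ⟶ Q), Mono j ∧ P Y ∧ ¬IsZero Y) : P M := by
  obtain ⟨N, hN⟩ := exists_maximal_of_wellFoundedGT (fun N : Subobject M => P (N : C))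
    ⟨⊥, P.prop_of_isZero ((isZero_zero C).of_iso Subobject.botCoeIsoZero)⟩
  let p := cokernel.π N.arrow
  have hK : P (kernel p) := P.prop_of_iso (asIso (Abelian.factorThruImage N.arrow)) hN.prop
  suffices hQ : IsZero (cokernel N.arrow) from
    prop_of_prop_kernel P p hK (P.prop_of_isZero hQ)
  by_contra hQ
  obtain ⟨Y, j, _, hY, hY0⟩ := h _ p hK hQ
  let N' := Subobject.mk (pullback.fst p j)
  have hle : N ≤ N' := Subobject.le_mk_of_comm
    (pullback.lift N.arrow 0 (by rw [cokernel.condition, zero_comp])) (pullback.lift_fst _ _ _)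
  have hge : N' ≤ N := hN.le_of_ge
    (P.prop_of_iso (Subobject.underlyingIso _).symm (prop_pullback P p j hK hY)) hle
  have hj : pullback.snd p j ≫ j = 0 := by
    rw [← pullback.condition, ← Subobject.ofMkLE_arrow hge, Category.assoc, cokernel.condition,
      comp_zero]
  obtain rfl : j = 0 := by rwa [← cancel_epi (pullback.snd p j), comp_zero]
  exact hY0 (IsZero.of_mono_zero Y (cokernel N.arrow))

theorem exists_minimal_mono [P.IsClosedUnderIsomorphisms] [IsArtinianObject M] (hM : P M)
    (hM0 : ¬IsZero M) :
    ∃ (Y : C) (i : Y ⟶ M), Mono i ∧ P Y ∧ ¬IsZero Y ∧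
      ∀ (Z : C) (f : Z ⟶ Y) [Mono f], P Z → ¬IsZero Z → IsIso f := by
  have htop : ((⊤ : Subobject M) : C) ≅ M := asIso (⊤ : Subobject M).arrow
  obtain ⟨N, hN⟩ := exists_minimal_of_wellFoundedLT
    (fun N : Subobject M => P (N : C) ∧ ¬IsZero (N : C))
    ⟨⊤, P.prop_of_iso htop.symm hM, fun h => hM0 (h.of_iso htop.symm)⟩
  refine ⟨N, N.arrow, inferInstance, hN.prop.1, hN.prop.2, fun Z f _ hZ hZ0 => ?_⟩
  have e := Subobject.underlyingIso (f ≫ N.arrow)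
  have hle : N ≤ Subobject.mk (f ≫ N.arrow) := hN.le_of_le
    ⟨P.prop_of_iso e.symm hZ, fun h => hZ0 (h.of_iso e.symm)⟩
    (Subobject.mk_le_of_comm f rfl)
  have hsec : Subobject.ofLEMk N (f ≫ N.arrow) hle ≫ f = 𝟙 _ := by
    rw [← cancel_mono N.arrow, Category.assoc, Subobject.ofLEMk_comp, Category.id_comp]
  have : Epi f := (SplitEpi.mk _ hsec).epi
  exact isIso_of_mono_of_epi f

theorem subobject_pullback_injective {X Y : C} (f : X ⟶ Y) [Epi f] :
    Function.Injective (Subobject.pullback f).obj := by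
  have key {A B : Subobject Y}
      (h : (Subobject.pullback f).obj A ≤ (Subobject.pullback f).obj B) : A ≤ B := by
    have hA : A.arrow ≫ cokernel.π B.arrow = 0 := by
      rw [← cancel_epi (Subobject.pullbackπ f A), reassoc_of% (Subobject.isPullback f A).w,
        ← Subobject.ofLE_arrow h, Category.assoc, ← reassoc_of% (Subobject.isPullback f B).w,
        cokernel.condition]
      simp only [comp_zero]
    exact Subobject.le_of_comm (Abelian.monoLift B.arrow _ hA) (Abelian.monoLift_comp _ _ hA)
  exact fun A B h => le_antisymm (key h.le) (key h.ge)

/-- The kernels of the iterates of `f` form an ascending chain, strict as soon as `ker f ≠ 0`. -/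
theorem isIso_of_epi_endo [IsNoetherianObject M] (f : M ⟶ M) [Epi f] : IsIso f := by
  have hmono : StrictMono (Subobject.pullback f).obj :=
    (Subobject.pullback f).monotone.strictMono_of_injective (subobject_pullback_injective f)
  have hbot : (Subobject.pullback f).obj ⊥ = ⊥ := by
    by_contra h
    exact not_strictMono_of_isNoetherianObject _
      (hmono.strictMono_iterate_of_lt_map (bot_lt_iff_ne_bot.2 h))
  have hker : kernelSubobject f = ⊥ := by
    rw [← hbot]
    exact (pullback_bot_of_shortExact (shortExact_of_epi f)).symm
  have : Mono f := by
    refine Preadditive.mono_of_kernel_zero ?_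
    exact Subobject.mk_eq_bot_iff_zero.1 hker
  exact isIso_of_mono_of_epi f

end ChainConditions

section TorsionClasses

instance (T : Tors C) : T.1.ContainsZero := T.2.toContainsZero
instance (T : Tors C) : T.1.IsClosedUnderQuotients := T.2.toIsClosedUnderQuotients
instance (T : Tors C) : T.1.IsClosedUnderExtensions := T.2.toIsClosedUnderExtensions

variable {P Q : ObjectProperty C} {T : Tors C} {B B' M : C}

theorem le_torsGen (P : ObjectProperty C) : P ≤ (torsGen P).1 := (isLeast_torsGen P).1

theorem torsGen_le_iff : torsGen P ≤ T ↔ P ≤ T.1 :=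
  ⟨fun h => (le_torsGen P).trans h, fun h => (isLeast_torsGen P).2 h⟩

theorem torsGen_mono (h : P ≤ Q) : torsGen P ≤ torsGen Q :=
  torsGen_le_iff.2 (h.trans (le_torsGen Q))

theorem torsGen_filt (P : ObjectProperty C) : torsGen (Filt P) = torsGen P :=
  le_antisymm (torsGen_le_iff.2 (filt_le (le_torsGen P))) (torsGen_mono (le_filt P))

theorem torsGen_isoClosure (P : ObjectProperty C) : torsGen P.isoClosure = torsGen P :=
  le_antisymm (torsGen_le_iff.2 ((ObjectProperty.isoClosure_le_iff _ _).2 (le_torsGen P)))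
    (torsGen_mono P.le_isoClosure)

theorem torsGen_singleton_le_iff : torsGen (.singleton B) ≤ T ↔ T.1 B :=
  torsGen_le_iff.trans (ObjectProperty.singleton_le_iff ..)

theorem mem_torsGen_singleton (B : C) : (torsGen (.singleton B)).1 B :=
  torsGen_singleton_le_iff.1 le_rfl

theorem torsGen_singleton_congr (e : B ≅ B') :
    torsGen (.singleton B) = torsGen (.singleton B') :=
  le_antisymm
    (torsGen_singleton_le_iff.2 (ObjectProperty.prop_of_iso _ e.symm (mem_torsGen_singleton B')))
    (torsGen_singleton_le_iff.2 (ObjectProperty.prop_of_iso _ e (mem_torsGen_singleton B)))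

theorem sSup_eq_torsGen (A : Set (Tors C)) : sSup A = torsGen fun X => ∃ U ∈ A, U.1 X :=
  le_antisymm (sSup_le fun U hU X hX => le_torsGen _ X ⟨U, hU, hX⟩)
    (torsGen_le_iff.2 fun X ⟨_, hU, hX⟩ => le_sSup hU X hX)

/-- The torsion classes `T(B)` generated by a single object `B` with property `P`: for a semibrick
`P` they form the canonical join representation of `T(P)`. -/
def principalTors (P : ObjectProperty C) : Set (Tors C) :=
  {U | ∃ B, P B ∧ torsGen (.singleton B) = U}

theorem torsGen_eq_sSup_principalTors (P : ObjectProperty C) :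
    torsGen P = sSup (principalTors P) := by
  refine le_antisymm (torsGen_le_iff.2 fun B hB => ?_) (sSup_le ?_)
  · exact torsGen_singleton_le_iff.1 (le_sSup ⟨B, hB, rfl⟩)
  · rintro _ ⟨B, hB, rfl⟩
    exact torsGen_singleton_le_iff.2 (le_torsGen P B hB)

end TorsionClasses

section Orthogonal

variable {P : ObjectProperty C} {M : C}

theorem not_isZero_image {X Y : C} {f : X ⟶ Y} (hf : f ≠ 0) : ¬IsZero (Abelian.image f) :=
  fun h => hf (by rw [← Abelian.image.fac f, h.eq_of_src (Abelian.image.ι f) 0, comp_zero])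

theorem isTorsionClass_leftOrthogonal (P : ObjectProperty C) :
    IsTorsionClass P.leftOrthogonal where
  exists_zero := ⟨_, isZero_zero C, fun _ _ _ => (isZero_zero C).eq_of_src _ _⟩
  prop_of_epi p _ hX _ g hZ := by rw [← cancel_epi p, hX (p ≫ g) hZ, comp_zero]
  prop_X₂_of_shortExact {S} hS h₁ h₃ _ g hZ := by
    have := hS.epi_g
    rw [← hS.exact.g_desc g (h₁ _ hZ), h₃ (hS.exact.desc g _) hZ, comp_zero]

theorem torsGen_le_leftOrthogonal_rightOrthogonal (P : ObjectProperty C) :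
    (torsGen P).1 ≤ P.rightOrthogonal.leftOrthogonal :=
  have hP : P ≤ P.rightOrthogonal.leftOrthogonal := fun _ hX _ f hY => hY f hX
  torsGen_le_iff (T := ⟨_, isTorsionClass_leftOrthogonal _⟩).2 hP

theorem exists_hom_ne_zero (h : (torsGen P).1 M) (hM : ¬IsZero M) :
    ∃ X, P X ∧ ∃ f : X ⟶ M, f ≠ 0 := by
  by_contra! h0
  exact hM ((IsZero.iff_id_eq_zero M).2
    (torsGen_le_leftOrthogonal_rightOrthogonal P M h (𝟙 M) fun X f hX => h0 X hX f))

theorem exists_hom_ne_zero_of_mem_torsGen_singleton {B : C} (h : (torsGen (.singleton B)).1 M)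
    (hM : ¬IsZero M) : ∃ f : B ⟶ M, f ≠ 0 := by
  obtain ⟨_, ⟨⟩, hf⟩ := exists_hom_ne_zero h hM
  exact hf

theorem mem_torsGen_iff [IsNoetherianObject M] :
    (torsGen P).1 M ↔ P.rightOrthogonal.leftOrthogonal M := by
  refine ⟨torsGen_le_leftOrthogonal_rightOrthogonal P M, fun h => ?_⟩
  refine prop_of_forall_quotient_exists_mono fun Q p _ _ hQ => ?_
  have hQP : ¬P.rightOrthogonal Q := fun hQP => hQ (by
    obtain rfl := h p hQP
    exact IsZero.of_epi_zero M Q)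
  simp only [ObjectProperty.rightOrthogonal_iff, not_forall] at hQP
  obtain ⟨X, f, hX, hf⟩ := hQP
  exact ⟨Abelian.image f, Abelian.image.ι f, inferInstance,
    (torsGen P).1.prop_of_epi (Abelian.factorThruImage f) (le_torsGen P X hX), not_isZero_image hf⟩

end Orthogonal

section WL

variable {T : Tors C}

theorem isPullback_of_exact {S : ShortComplex C} (hS : S.Exact) [Mono S.f] {X : C}
    (f : X ⟶ S.X₂) :
    IsPullback (hS.lift (kernel.ι (f ≫ S.g) ≫ f) (by simp)) (kernel.ι (f ≫ S.g)) S.f f :=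
  .of_isLimit' ⟨hS.lift_f _ _⟩ <| PullbackCone.IsLimit.mk _
    (fun s => kernel.lift _ s.snd (by rw [← reassoc_of% s.condition, S.zero, comp_zero]))
    (fun s => by
      rw [← cancel_mono S.f, Category.assoc, hS.lift_f, kernel.lift_ι_assoc, s.condition])
    (fun s => kernel.lift_ι _ _ _)
    (fun s m _ h => by rw [← cancel_mono (kernel.ι _), h, kernel.lift_ι])

instance (T : Tors C) : (WL T).ContainsZero where
  exists_zero := ⟨_, isZero_zero C, T.1.prop_of_isZero (isZero_zero C), fun X f hX => by
    obtain rfl : f = 0 := (isZero_zero C).eq_of_tgt _ _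
    exact T.1.prop_of_iso kernelZeroIsoSource.symm hX⟩

instance (T : Tors C) : (WL T).IsClosedUnderExtensions where
  prop_X₂_of_shortExact {S} hS h₁ h₃ := by
    have := hS.mono_f
    refine ⟨T.1.prop_X₂_of_shortExact hS h₁.1 h₃.1, fun X f hX => ?_⟩
    have hK : T.1 (kernel (f ≫ S.g)) := h₃.2 X (f ≫ S.g) hX
    exact (prop_kernel_iff_of_isPullback T.1 (isPullback_of_exact hS.exact f)).1 (h₁.2 _ _ hK)

theorem WL_kernel {X Y : C} (f : X ⟶ Y) (hX : WL T X) (hY : WL T Y) : WL T (kernel f) :=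
  ⟨hY.2 X f hX.1, fun Z g hZ =>
    T.1.prop_of_iso (kernelCompMono g (kernel.ι f)) (hX.2 Z (g ≫ kernel.ι f) hZ)⟩

theorem WL_of_epi {X Y : C} (p : X ⟶ Y) [Epi p] (hK : T.1 (kernel p)) (hX : WL T X) : WL T Y := by
  refine ⟨T.1.prop_of_epi p hX.1, fun Z g hZ => ?_⟩
  rw [← prop_kernel_iff_of_isPullback T.1 (IsPullback.of_hasPullback p g)]
  exact hX.2 _ _ (prop_pullback T.1 p g hK hZ)

theorem isWide_WL (T : Tors C) : IsWide (WL T) where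
  exists_zero := ObjectProperty.ContainsZero.exists_zero
  kernels_le := by
    rintro _ ⟨f, k, hk, hX, hY⟩
    exact (WL T).prop_of_iso ((kernelIsKernel f).conePointUniqueUpToIso hk) (WL_kernel f hX hY)
  cokernels_le := by
    rintro _ ⟨f, k, hk, hX, hY⟩
    refine (WL T).prop_of_iso ((cokernelIsCokernel f).coconePointUniqueUpToIso hk) ?_
    exact WL_of_epi (cokernel.π f) (T.1.prop_of_epi (Abelian.factorThruImage f) hX.1) hY
  prop_X₂_of_shortExact := ObjectProperty.prop_X₂_of_shortExact _

end WL

section Bricks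

variable {B B' : C}

theorem IsBrick.not_isZero (h : IsBrick B) : ¬IsZero B := fun hB =>
  have := h.1
  one_ne_zero (α := End B) (hB.eq_of_src _ _)

theorem IsBrick.isIso (h : IsBrick B) {f : B ⟶ B} (hf : f ≠ 0) : IsIso f :=
  (isUnit_iff_isIso f).1 (h.2 f hf)

theorem isBrick_of_isIso (hB : ¬IsZero B) (h : ∀ f : B ⟶ B, f ≠ 0 → IsIso f) : IsBrick B :=
  ⟨⟨𝟙 B, 0, fun h0 => hB ((IsZero.iff_id_eq_zero B).2 h0)⟩, fun f hf =>
    (isUnit_iff_isIso f).2 (h f hf)⟩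

theorem IsBrick.of_iso (e : B ≅ B') (h : IsBrick B) : IsBrick B' := by
  refine isBrick_of_isIso (fun h' => h.not_isZero (h'.of_iso e)) fun f hf => ?_
  have : IsIso (e.hom ≫ f ≫ e.inv) := h.isIso fun h0 => hf (by
    rwa [← cancel_mono e.inv, ← cancel_epi e.hom, zero_comp, comp_zero])
  have : IsIso (f ≫ e.inv) := IsIso.of_isIso_comp_left e.hom _
  exact IsIso.of_isIso_comp_right f e.inv

theorem isSemibrick_isoClosure_singleton (hB : IsBrick B) :
    IsSemibrick (ObjectProperty.singleton B).isoClosure where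
  of_iso e h := ObjectProperty.prop_of_iso _ e h
  isBrick := by
    rintro X ⟨_, ⟨⟩, ⟨e⟩⟩
    exact hB.of_iso e.symm
  hom_eq_zero := by
    rintro X X' ⟨_, ⟨⟩, ⟨e⟩⟩ ⟨_, ⟨⟩, ⟨e'⟩⟩ h
    exact absurd ⟨e ≪≫ e'.symm⟩ h

end Bricks

section Semibricks

variable {S : ObjectProperty C}

theorem IsSemibrick.isIso (hS : IsSemibrick S) {B B' : C} (hB : S B) (hB' : S B') {f : B ⟶ B'}
    (hf : f ≠ 0) : IsIso f := by
  obtain ⟨e⟩ : Nonempty (B ≅ B') := by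
    by_contra h
    exact hf (hS.hom_eq_zero B B' hB hB' h f)
  have : IsIso (f ≫ e.inv) := (hS.isBrick B hB).isIso fun h0 => hf (by
    rwa [← cancel_mono e.inv, zero_comp])
  exact IsIso.of_isIso_comp_right f e.inv

theorem IsSemibrick.epi (hS : IsSemibrick S) {X B : C} (hB : S B) (hX : (torsGen S).1 X)
    {f : X ⟶ B} (hf : f ≠ 0) : Epi f := by
  obtain ⟨B', hB', g, hg⟩ := exists_hom_ne_zero
    ((torsGen S).1.prop_of_epi (Abelian.factorThruImage f) hX) (not_isZero_image hf)
  have : IsIso (g ≫ Abelian.image.ι f) := hS.isIso hB' hB fun h => hg (by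
    rwa [← cancel_mono (Abelian.image.ι f), zero_comp])
  have : Epi (Abelian.image.ι f) := epi_of_epi g _
  rw [← Abelian.image.fac f]
  exact epi_comp _ _

theorem IsBrick.epi_of_mem_torsGen_singleton {X B : C} (hB : IsBrick B)
    (hX : (torsGen (.singleton B)).1 X) {f : X ⟶ B} (hf : f ≠ 0) : Epi f :=
  (isSemibrick_isoClosure_singleton hB).epi (ObjectProperty.le_isoClosure _ _ (by simp))
    (by rwa [torsGen_isoClosure]) hf

theorem shortExact_pushout {E : ShortComplex C} (hE : E.ShortExact) {N : C} (q : E.X₁ ⟶ N) :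
    (ShortComplex.mk (pushout.inr E.f q) (pushout.desc E.g 0 (by rw [E.zero, comp_zero]))
      (pushout.inr_desc _ _ _)).ShortExact := by
  have := hE.mono_f
  have := hE.epi_g
  have w : E.f ≫ E.g = q ≫ (0 : N ⟶ E.X₃) := by rw [E.zero, comp_zero]
  have hepi : Epi (pushout.desc E.g 0 w) := epi_of_epi_fac (pushout.inl_desc E.g 0 w)
  refine .mk' (ShortComplex.exact_of_g_is_cokernel _ <|
    CokernelCofork.IsColimit.ofπ' _ _ fun k hk => ?_)
    (inferInstanceAs (Mono (pushout.inr E.f q))) hepi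
  have hk' : E.f ≫ pushout.inl E.f q ≫ k = 0 := by
    rw [pushout.condition_assoc, hk, comp_zero]
  refine ⟨hE.exact.desc _ hk', pushout.hom_ext ?_ ?_⟩
  · rw [pushout.inl_desc_assoc, hE.exact.g_desc]
  · rw [pushout.inr_desc_assoc, zero_comp]
    exact hk.symm

theorem IsSemibrick.rightOrthogonal_or_nonempty_splitting (hS : IsSemibrick S)
    {E : ShortComplex C} (hE : E.ShortExact) (h₁ : S.rightOrthogonal E.X₁) (h₃ : S E.X₃) :
    S.rightOrthogonal E.X₂ ∨ Nonempty E.Splitting := by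
  have := hE.mono_f
  by_cases h : ∃ (B : C) (g : B ⟶ E.X₂), S B ∧ g ≫ E.g ≠ 0
  · obtain ⟨B, g, hB, hg⟩ := h
    have := hS.isIso hB h₃ hg
    exact .inr ⟨.ofExactOfSection E hE.exact (inv (g ≫ E.g) ≫ g) (by simp) hE.mono_f⟩
  · push Not at h
    refine .inl fun B g hB => ?_
    rw [← hE.exact.lift_f g (h B g hB), h₁ (hE.exact.lift g _) hB, zero_comp]

/-- A map `q` from the kernel to some `N` in `S^⊥` vanishes: push the extension of `B` by the kernel
out along `q`, and use that there is no non-zero map from `X` to an object of `S^⊥`. -/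
theorem IsSemibrick.kernel_mem_torsGen (hS : IsSemibrick S) {X B : C} [IsNoetherianObject X]
    (hB : S B) (hX : (torsGen S).1 X) (f : X ⟶ B) : (torsGen S).1 (kernel f) := by
  by_cases hf : f = 0
  · subst hf
    exact (torsGen S).1.prop_of_iso kernelZeroIsoSource.symm hX
  have := hS.epi hB hX hf
  have := isNoetherianObject_of_mono (kernel.ι f)
  have hom_eq_zero {Y : C} (g : X ⟶ Y) (hY : S.rightOrthogonal Y) : g = 0 :=
    torsGen_le_leftOrthogonal_rightOrthogonal S X hX g hY
  refine mem_torsGen_iff.2 fun N q hN => ?_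
  have hE := shortExact_pushout (shortExact_of_epi f) q
  obtain hE₂ | ⟨⟨s⟩⟩ := hS.rightOrthogonal_or_nonempty_splitting hE hN hB
  · have hinl := hom_eq_zero (pushout.inl (kernel.ι f) q) hE₂
    have : Mono (pushout.inr (kernel.ι f) q) := hE.mono_f
    rw [← cancel_mono (pushout.inr (kernel.ι f) q), ← pushout.condition, hinl, comp_zero, zero_comp]
  · have hr : pushout.inr (kernel.ι f) q ≫ s.r = 𝟙 N := s.f_r
    have hinl := hom_eq_zero (pushout.inl (kernel.ι f) q ≫ s.r) hN
    rw [← Category.comp_id q, ← hr, ← pushout.condition_assoc, hinl, comp_zero]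

theorem IsSemibrick.mono_of_WL (hS : IsSemibrick S) {B M : C} (hB : S B)
    (hM : WL (torsGen S) M) {g : B ⟶ M} (hg : g ≠ 0) : Mono g := by
  refine Preadditive.mono_of_kernel_zero ?_
  by_contra h
  have : Epi (kernel.ι g) := hS.epi hB (hM.2 B g (le_torsGen S B hB)) h
  exact hg (by rw [← cancel_epi (kernel.ι g), kernel.condition, comp_zero])

variable [∀ X : C, IsNoetherianObject X]

theorem IsSemibrick.le_WL_torsGen (hS : IsSemibrick S) : S ≤ WL (torsGen S) :=
  fun B hB => ⟨le_torsGen S B hB, fun _ f hX => hS.kernel_mem_torsGen hB hX f⟩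

theorem IsSemibrick.WL_torsGen (hS : IsSemibrick S) : WL (torsGen S) = Filt S := by
  refine le_antisymm (fun M hM => ?_) (filt_le hS.le_WL_torsGen)
  refine prop_of_forall_quotient_exists_mono fun Q p _ hK hQ => ?_
  have hWQ : WL (torsGen S) Q := WL_of_epi p (filt_le (le_torsGen S) _ hK) hM
  obtain ⟨B, hB, g, hg⟩ := exists_hom_ne_zero hWQ.1 hQ
  exact ⟨B, g, hS.mono_of_WL hB hWQ hg, le_filt S B hB, (hS.isBrick B hB).not_isZero⟩

theorem IsSemibrick.isWide_filt (hS : IsSemibrick S) : IsWide (Filt S) :=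
  hS.WL_torsGen ▸ isWide_WL (torsGen S)

end Semibricks

section Wide

variable {W S : ObjectProperty C} {X Y : C}

theorem isIso_of_simp [W.IsClosedUnderKernels] (hX : TorsWide.simp W X) (hY : TorsWide.simp W Y)
    {f : X ⟶ Y} (hf : f ≠ 0) : IsIso f := by
  obtain ⟨hX, _⟩ := hX
  obtain ⟨hY, _⟩ := hY
  let g : (⟨X, hX⟩ : W.FullSubcategory) ⟶ ⟨Y, hY⟩ := ObjectProperty.homMk f
  have : IsIso g := isIso_of_hom_simple fun h => hf (congrArg W.ι.map h)
  exact inferInstanceAs (IsIso (W.ι.map g))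

theorem not_isZero_of_simp (h : TorsWide.simp W X) : ¬IsZero X := fun hX0 => by
  obtain ⟨hX, _⟩ := h
  exact id_nonzero (⟨X, hX⟩ : W.FullSubcategory) (W.ι.map_injective (hX0.eq_of_src _ _))

instance [W.IsClosedUnderIsomorphisms] : (TorsWide.simp W).IsClosedUnderIsomorphisms where
  of_iso {X _} e := fun ⟨hX, _⟩ =>
    ⟨W.prop_of_iso e hX, Simple.of_iso (Y := ⟨X, hX⟩) (W.isoMk e.symm)⟩

theorem isSemibrick_simp [W.IsClosedUnderIsomorphisms] [W.IsClosedUnderKernels] :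
    IsSemibrick (TorsWide.simp W) where
  of_iso := ObjectProperty.prop_of_iso _
  isBrick B hB := isBrick_of_isIso (not_isZero_of_simp hB) fun _ hf => isIso_of_simp hB hB hf
  hom_eq_zero B₁ B₂ h₁ h₂ h f := by
    by_contra hf
    have := isIso_of_simp h₁ h₂ hf
    exact h ⟨asIso f⟩

theorem simp_of_forall_mono [W.ContainsZero] [W.IsClosedUnderKernels] (hX : W X)
    (hX0 : ¬IsZero X) (h : ∀ (Y : C) (f : Y ⟶ X) [Mono f], W Y → ¬IsZero Y → IsIso f) :
    TorsWide.simp W X := by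
  refine ⟨hX, ⟨fun {Y} f _ => ⟨fun _ h0 => hX0 ?_, fun hf => ?_⟩⟩⟩
  · exact W.ι.map_isZero (IsZero.of_epi_eq_zero f h0)
  · have := W.preservesMonomorphisms_ι_of_isNormalEpiCategory
    have : IsIso (W.ι.map f) :=
      h Y.obj (W.ι.map f) Y.property fun h0 => hf (W.ι.map_injective (h0.eq_of_src _ _))
    exact isIso_of_reflects_iso f W.ι

theorem IsWide.filt_simp [∀ X : C, IsNoetherianObject X] [∀ X : C, IsArtinianObject X]
    (hW : IsWide W) : Filt (TorsWide.simp W) = W := by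
  have := hW.toContainsZero
  have := hW.toIsClosedUnderKernels
  have := hW.toIsClosedUnderCokernels
  have := hW.toIsClosedUnderExtensions
  have hle : Filt (TorsWide.simp W) ≤ W := filt_le fun _ hX => hX.1
  refine le_antisymm hle fun M hM => ?_
  refine prop_of_forall_quotient_exists_mono fun Q p _ hK hQ => ?_
  have hWQ : W Q := W.prop_of_isColimit_cokernelCofork
    (shortExact_of_epi p).gIsCokernel (hle _ hK) hM
  obtain ⟨Y, i, hi, hY, hY0, hmin⟩ := exists_minimal_mono hWQ hQ
  exact ⟨Y, i, hi, le_filt _ Y (simp_of_forall_mono hY hY0 hmin), hY0⟩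

theorem IsSemibrick.le_simp_filt [∀ X : C, IsNoetherianObject X] (hS : IsSemibrick S) :
    S ≤ TorsWide.simp (Filt S) := fun B hB => by
  have := hS.isWide_filt.toIsClosedUnderKernels
  refine simp_of_forall_mono (le_filt S B hB) (hS.isBrick B hB).not_isZero fun Y f _ hY hY0 => ?_
  have : Epi f :=
    hS.epi hB (filt_le (le_torsGen S) Y hY) fun h0 => hY0 (IsZero.of_mono_eq_zero f h0)
  exact isIso_of_mono_of_epi f

theorem IsSemibrick.simp_filt [∀ X : C, IsNoetherianObject X] (hS : IsSemibrick S) :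
    TorsWide.simp (Filt S) = S := by
  have := hS.isWide_filt.toIsClosedUnderKernels
  refine le_antisymm (fun M hM => ?_) hS.le_simp_filt
  obtain ⟨B, hB, f, hf⟩ := exists_hom_ne_zero (filt_le (le_torsGen S) M hM.1)
    (not_isZero_of_simp hM)
  have := isIso_of_simp (hS.le_simp_filt B hB) hM hf
  exact hS.of_iso (asIso f) hB

end Wide

section CanonicalJoinRepresentations

theorem IsCanonicalJoinRep.exists_le_of_le_sSup {L : Type*} [CompleteLattice L] {x a : L}
    {A D : Set L} (hA : IsCanonicalJoinRep x A) (ha : a ∈ A) (hD : ∀ d ∈ D, d ≤ x)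
    (h : a ≤ sSup (A \ {a} ∪ D)) : ∃ d ∈ D, a ≤ d := by
  have hx : x = sSup (A \ {a} ∪ D) := by
    refine le_antisymm ?_ (sSup_le ?_)
    · rw [hA.sSup_eq]
      refine sSup_le fun b hb => ?_
      by_cases hba : b = a
      · exact hba ▸ h
      · exact le_sSup (.inl ⟨hb, hba⟩)
    · rintro b (hb | hb)
      · exact hA.sSup_eq ▸ le_sSup hb.1
      · exact hD b hb
  obtain ⟨b, hb | hb, hab⟩ := hA.refines _ hx a ha
  · exact absurd (hA.antichain a ha b hb.1 hab).symm hb.2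
  · exact ⟨b, hb, hab⟩

variable {S : ObjectProperty C} {T U : Tors C} {A : Set (Tors C)} {B B' X : C}

theorem IsSemibrick.isCanonicalJoinRep (hS : IsSemibrick S) :
    IsCanonicalJoinRep (torsGen S) (principalTors S) where
  sSup_eq := torsGen_eq_sSup_principalTors S
  refines := by
    rintro A hA _ ⟨B, hB, rfl⟩
    have hBA : (sSup A).1 B := hA ▸ le_torsGen S B hB
    rw [sSup_eq_torsGen] at hBA
    obtain ⟨Y, ⟨U, hU, hY⟩, f, hf⟩ := exists_hom_ne_zero hBA (hS.isBrick B hB).not_isZero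
    have hYS : (torsGen S).1 Y := (hA ▸ le_sSup hU : U ≤ torsGen S) Y hY
    have := hS.epi hB hYS hf
    exact ⟨U, hU, torsGen_singleton_le_iff.2 (U.1.prop_of_epi f hY)⟩
  antichain := by
    rintro _ ⟨B, hB, rfl⟩ _ ⟨B', hB', rfl⟩ h
    obtain ⟨f, hf⟩ := exists_hom_ne_zero_of_mem_torsGen_singleton (torsGen_singleton_le_iff.1 h)
      (hS.isBrick B hB).not_isZero
    have := hS.isIso hB' hB hf
    exact torsGen_singleton_congr (asIso f).symm

theorem IsBrick.exists_epi (hB' : IsBrick B')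
    (h : torsGen (.singleton B) = torsGen (.singleton B')) : ∃ f : B ⟶ B', Epi f := by
  obtain ⟨f, hf⟩ := exists_hom_ne_zero_of_mem_torsGen_singleton (h ▸ mem_torsGen_singleton B')
    hB'.not_isZero
  exact ⟨f, hB'.epi_of_mem_torsGen_singleton (h ▸ mem_torsGen_singleton B) hf⟩

theorem IsBrick.nonempty_iso (hB : IsBrick B) (hB' : IsBrick B')
    (h : torsGen (.singleton B) = torsGen (.singleton B')) : Nonempty (B ≅ B') := by
  obtain ⟨f, _⟩ := hB'.exists_epi h
  obtain ⟨g, _⟩ := hB.exists_epi h.symm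
  have : IsIso (f ≫ g) := hB.isIso fun h0 => hB.not_isZero (IsZero.of_epi_eq_zero _ h0)
  have : Mono f := mono_of_mono f g
  have := isIso_of_mono_of_epi f
  exact ⟨asIso f⟩

theorem IsSemibrick.brickCJR_torsGen (hS : IsSemibrick S) : brickCJR (torsGen S) = S := by
  ext B
  rw [brickCJR, hS.isCanonicalJoinRep.cjr_eq]
  constructor
  · rintro ⟨hB, B', hB', h⟩
    obtain ⟨e⟩ := (hS.isBrick B' hB').nonempty_iso hB h
    exact hS.of_iso e hB'
  · exact fun hB => ⟨hS.isBrick B hB, B, hB, rfl⟩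

theorem IsBrick.eq_zero_of_mem_torsGen_cokernel (hB : IsBrick B) {f : X ⟶ B}
    (h : (torsGen (.singleton (cokernel f))).1 B) : f = 0 := by
  obtain ⟨g, hg⟩ := exists_hom_ne_zero_of_mem_torsGen_singleton h hB.not_isZero
  have : IsIso (cokernel.π f ≫ g) := hB.isIso fun h0 => hg (by
    rw [← cancel_epi (cokernel.π f), h0, comp_zero])
  rw [← cancel_mono (cokernel.π f ≫ g), cokernel.condition_assoc, zero_comp, zero_comp]

/-- A map `f : B₁ ⟶ B₂` exhibits `B₂` as an extension of `coker f` by a quotient of `B₁`, so that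
`T(coker f)` could replace `T(B₂)` in the join. -/
theorem IsCanonicalJoinRep.isSemibrick_brickCJR (hA : IsCanonicalJoinRep T A) :
    IsSemibrick (brickCJR T) where
  of_iso e h := ⟨h.1.of_iso e, torsGen_singleton_congr e ▸ h.2⟩
  isBrick _ h := h.1
  hom_eq_zero B₁ B₂ := by
    rintro ⟨hB₁, h₁⟩ ⟨hB₂, h₂⟩ hne f
    rw [hA.cjr_eq] at h₁ h₂
    have hB₂T : T.1 B₂ := torsGen_singleton_le_iff.1 (hA.sSup_eq ▸ le_sSup h₂)
    let V := sSup (A \ {torsGen (.singleton B₂)} ∪ {torsGen (.singleton (cokernel f))})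
    have hV₁ : V.1 B₁ :=
      torsGen_singleton_le_iff.1 (le_sSup (.inl ⟨h₁, fun h => hne (hB₁.nonempty_iso hB₂ h)⟩))
    have hVcoker : V.1 (cokernel f) := torsGen_singleton_le_iff.1 (le_sSup (.inr rfl))
    have hV₂ : V.1 B₂ := prop_of_prop_kernel V.1 (cokernel.π f)
      (V.1.prop_of_epi (Abelian.factorThruImage f) hV₁) hVcoker
    obtain ⟨_, rfl, hle⟩ := hA.exists_le_of_le_sSup h₂
      (by
        rintro _ rfl
        exact torsGen_singleton_le_iff.2 (T.1.prop_of_epi (cokernel.π f) hB₂T))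
      (torsGen_singleton_le_iff.2 hV₂)
    exact hB₂.eq_zero_of_mem_torsGen_cokernel (torsGen_singleton_le_iff.1 hle)

/-- A minimal non-zero subobject in `T` is a brick: a non-zero endomorphism has its image in `T`,
hence is epi. -/
theorem exists_brick_mono [IsNoetherianObject X] [IsArtinianObject X] (hX : T.1 X)
    (hX0 : ¬IsZero X) :
    ∃ (B : C) (i : B ⟶ X), Mono i ∧ IsBrick B ∧ T.1 B := by
  obtain ⟨B, i, hi, hB, hB0, hmin⟩ := exists_minimal_mono hX hX0
  refine ⟨B, i, hi, isBrick_of_isIso hB0 fun f hf => ?_, hB⟩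
  have := isNoetherianObject_of_mono i
  have : IsIso (Abelian.image.ι f) := hmin _ _
    (T.1.prop_of_epi (Abelian.factorThruImage f) hB) (not_isZero_image hf)
  have : Epi f := by
    rw [← Abelian.image.fac f]
    infer_instance
  exact isIso_of_epi_endo f

section LengthCategory

variable [∀ X : C, IsNoetherianObject X] [∀ X : C, IsArtinianObject X]

theorem torsGen_bricks (T : Tors C) : torsGen (fun B => IsBrick B ∧ T.1 B) = T := by
  refine le_antisymm (torsGen_le_iff.2 fun B hB => hB.2) fun M hM => ?_
  refine prop_of_forall_quotient_exists_mono fun Q p _ _ hQ => ?_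
  obtain ⟨B, i, hi, hB, hBT⟩ := exists_brick_mono (T.1.prop_of_epi p hM) hQ
  exact ⟨B, i, hi, le_torsGen _ B ⟨hB, hBT⟩, hB.not_isZero⟩

theorem IsCanonicalJoinRep.exists_brick (hA : IsCanonicalJoinRep T A) (hU : U ∈ A) :
    ∃ B, IsBrick B ∧ torsGen (.singleton B) = U := by
  have hUT : U ≤ T := hA.sSup_eq ▸ le_sSup hU
  let D := principalTors fun B => IsBrick B ∧ U.1 B
  have hU_eq : U = sSup D := by rw [← torsGen_eq_sSup_principalTors, torsGen_bricks]
  have hDT : ∀ V ∈ D, V ≤ T := fun V hV => (hU_eq ▸ le_sSup hV : V ≤ U).trans hUT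
  obtain ⟨_, ⟨B, ⟨hB, hBU⟩, rfl⟩, hle⟩ := hA.exists_le_of_le_sSup hU hDT
    (hU_eq.le.trans (sSup_le_sSup Set.subset_union_right))
  exact ⟨B, hB, le_antisymm (torsGen_singleton_le_iff.2 hBU) hle⟩

theorem IsCanonicalJoinRep.torsGen_brickCJR (hA : IsCanonicalJoinRep T A) :
    torsGen (brickCJR T) = T := by
  have h : principalTors (brickCJR T) = A := by
    rw [← hA.cjr_eq]
    refine Set.Subset.antisymm ?_ fun U hU => ?_
    · rintro _ ⟨B, hB, rfl⟩
      exact hB.2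
    · obtain ⟨B, hB, rfl⟩ := hA.exists_brick (hA.cjr_eq ▸ hU)
      exact ⟨B, ⟨hB, hU⟩, rfl⟩
  rw [torsGen_eq_sSup_principalTors, h, hA.sSup_eq]

end LengthCategory

end CanonicalJoinRepresentations

section Bijections

variable {W : ObjectProperty C} {T : Tors C}

theorem mapsTo_torsGen_sbrick : Set.MapsTo torsGen (sbrick C) (canonicalElements (Tors C)) :=
  fun _ hS => ⟨_, IsSemibrick.isCanonicalJoinRep hS⟩

theorem mapsTo_brickCJR : Set.MapsTo brickCJR (canonicalElements (Tors C)) (sbrick C) :=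
  fun _ ⟨_, hA⟩ => hA.isSemibrick_brickCJR

theorem mapsTo_simp : Set.MapsTo TorsWide.simp (wide C) (sbrick C) := fun _ hW =>
  have := hW.toContainsZero
  have := hW.toIsClosedUnderKernels
  have := hW.toIsClosedUnderExtensions
  isSemibrick_simp

variable [∀ X : C, IsNoetherianObject X]

theorem mapsTo_filt : Set.MapsTo Filt (sbrick C) (wide C) := fun _ hS => IsSemibrick.isWide_filt hS

variable [∀ X : C, IsArtinianObject X]

theorem torsGen_simp (hW : W ∈ wide C) : torsGen (TorsWide.simp W) = torsGen W := by
  rw [← torsGen_filt, IsWide.filt_simp hW]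

theorem mapsTo_torsGen_wide : Set.MapsTo torsGen (wide C) (canonicalElements (Tors C)) :=
  fun _ hW => torsGen_simp hW ▸ mapsTo_torsGen_sbrick (mapsTo_simp hW)

theorem invOn_simp_filt : Set.InvOn TorsWide.simp Filt (sbrick C) (wide C) :=
  ⟨fun _ hS => IsSemibrick.simp_filt hS, fun _ hW => IsWide.filt_simp hW⟩

theorem invOn_brickCJR_torsGen :
    Set.InvOn brickCJR torsGen (sbrick C) (canonicalElements (Tors C)) :=
  ⟨fun _ hS => IsSemibrick.brickCJR_torsGen hS, fun _ ⟨_, hA⟩ => hA.torsGen_brickCJR⟩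

theorem filt_brickCJR (hT : T ∈ canonicalElements (Tors C)) : Filt (brickCJR T) = WL T := by
  rw [← IsSemibrick.WL_torsGen (mapsTo_brickCJR hT), invOn_brickCJR_torsGen.2 hT]

theorem simp_WL (hT : T ∈ canonicalElements (Tors C)) : TorsWide.simp (WL T) = brickCJR T := by
  rw [← filt_brickCJR hT, invOn_simp_filt.1 (mapsTo_brickCJR hT)]

theorem invOn_WL_torsGen : Set.InvOn WL torsGen (wide C) (canonicalElements (Tors C)) := by
  refine ⟨fun W hW => ?_, fun T hT => ?_⟩
  · rw [← torsGen_simp hW, IsSemibrick.WL_torsGen (mapsTo_simp hW), IsWide.filt_simp hW]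
  · rw [← filt_brickCJR hT, torsGen_filt, invOn_brickCJR_torsGen.2 hT]

theorem isWidelyGenerated_iff :
    IsWidelyGenerated T ↔ ∃ A : Set (Tors C), IsCanonicalJoinRep T A := by
  constructor
  · rintro ⟨W, hW, rfl⟩
    exact mapsTo_torsGen_wide hW
  · exact fun hT => ⟨WL T, isWide_WL T, (invOn_WL_torsGen.2 hT).symm⟩

end Bijections

end TorsWide

theorem theorem4 {C : Type u} [Category.{v} C] [Abelian C] (hC : IsLengthCategory C) :
    -- (1) widely generated torsion classes
    (∀ T : Tors C, IsWidelyGenerated T ↔ ∃ A : Set (Tors C), IsCanonicalJoinRep T A) ∧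
    -- (2) wide subcategories
    (Set.BijOn torsGen (wide C) (canonicalElements (Tors C)) ∧
      Set.BijOn WL (canonicalElements (Tors C)) (wide C) ∧
      Set.InvOn WL torsGen (wide C) (canonicalElements (Tors C))) ∧
    -- (3) semibricks
    ((∀ T ∈ canonicalElements (Tors C), IsSemibrick (brickCJR T)) ∧
      Set.BijOn torsGen (sbrick C) (canonicalElements (Tors C)) ∧
      Set.BijOn brickCJR (canonicalElements (Tors C)) (sbrick C) ∧
      Set.InvOn brickCJR torsGen (sbrick C) (canonicalElements (Tors C))) ∧
    -- (4) the commutative square of bijections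
    (Set.BijOn Filt (sbrick C) (wide C) ∧
      Set.BijOn TorsWide.simp (wide C) (sbrick C) ∧
      Set.InvOn TorsWide.simp Filt (sbrick C) (wide C) ∧
      (∀ S ∈ sbrick C, torsGen (Filt S) = torsGen S) ∧
      (∀ W ∈ wide C, torsGen (TorsWide.simp W) = torsGen W) ∧
      (∀ T ∈ canonicalElements (Tors C), Filt (brickCJR T) = WL T) ∧
      (∀ T ∈ canonicalElements (Tors C), TorsWide.simp (WL T) = brickCJR T)) := by
  have := hC.isNoetherianObject
  have := hC.isArtinianObject
  have mapsTo_WL : Set.MapsTo WL (canonicalElements (Tors C)) (wide C) := fun T _ => isWide_WL T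
  exact ⟨fun _ => isWidelyGenerated_iff,
    ⟨invOn_WL_torsGen.bijOn mapsTo_torsGen_wide mapsTo_WL,
      invOn_WL_torsGen.symm.bijOn mapsTo_WL mapsTo_torsGen_wide,
      invOn_WL_torsGen⟩,
    ⟨fun _ hT => mapsTo_brickCJR hT,
      invOn_brickCJR_torsGen.bijOn mapsTo_torsGen_sbrick mapsTo_brickCJR,
      invOn_brickCJR_torsGen.symm.bijOn mapsTo_brickCJR mapsTo_torsGen_sbrick,
      invOn_brickCJR_torsGen⟩,
    ⟨invOn_simp_filt.bijOn mapsTo_filt mapsTo_simp,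
      invOn_simp_filt.symm.bijOn mapsTo_simp mapsTo_filt,
      invOn_simp_filt,
      fun S _ => torsGen_filt S,
      fun _ hW => torsGen_simp hW,
      fun _ hT => filt_brickCJR hT,
      fun _ hT => simp_WL hT⟩⟩
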